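/- Theorem 1. Consider $n$ users and $d\ge 2$ time periods. Each user $u$ holds a Boolean sequence $x_u\in\{0,1\}^d$ with at most $k\ge 1$ changes, i.e. $x_u[t]\neq x_u[t-1]$ for at most $k$ indices $t\in\{2,\dots,d\}$; let $f[t]=\sum_{u=1}^n x_u[t]$ be the number of users with value $1$ at time $t$. In an online protocol each user, with private randomness that is independent between users, sends at each time $t$ a report that depends only on that randomness and on $x_u[1],\dots,x_u[t]$, and the server then outputs an estimate $\hat f[t]$ computed from the reports sent up to time $t$. The protocol is $\varepsilon$-locally differentially private if, for each user, the law $\mathcal A(x)$ of the whole sequence of the user's $d$ reports, as a function of the user's data $x$, satisfies $\Pr[\mathcal A(x)\in Y]\le e^{\varepsilon}\Pr[\mathcal A(x')\in Y]$ for all $x,x'\in\{0,1\}^d$ with at most $k$ changes and all measurable $Y$. There is a universal constant $C>0$ such that the following holds for all integers $n\ge 0$, $d\ge 2$, $k\ge 1$ and all real $\varepsilon\in(0,1]$, $\beta\in(0,1)$ with $$\varepsilon^{-1}\cdot(\log_2 d)\cdot\sqrt{k\cdot\ln(d/\beta)}\le\sqrt n .$$ There is an $\varepsilon$-locally differentially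 private online protocol such that, for all data of the users (each sequence with at most $k$ changes), with probability at least $1-\beta$, $$\max_{1\le t\le d}\bigl|\hat f[t]-f[t]\bigr|\le C\cdot\frac{\log_2 d}{\varepsilon}\cdot\sqrt{k\cdot n\cdot\ln\frac d\beta}\,.$$ -/

import Mathlib

open MeasureTheory

namespace LongitudinalLDP

/-- Number of changes of a Boolean sequence `x`: the number of periods, other than the first,
whose value differs from that of the preceding period. -/
def numChanges {d : ℕ} (x : Fin d → Bool) : ℕ :=
  (Finset.univ.filter fun t : Fin d => ∃ s : Fin d, (s : ℕ) + 1 = (t : ℕ) ∧ x s ≠ x t).card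

/-- The possible data of one user: Boolean sequences over `d` periods with at most `k` changes. -/
def UserData (d k : ℕ) : Type := {x : Fin d → Bool // numChanges x ≤ k}

/-- `truth x t` is the number of users whose value at time `t` is `1`. -/
def truth {n d k : ℕ} (x : Fin n → UserData d k) (t : Fin d) : ℕ :=
  (Finset.univ.filter fun u : Fin n => (x u).1 t = true).card

/-- The values up to and including time `t` of a sequence indexed by the `d` periods. -/
def upTo {α : Type} {d : ℕ} (x : Fin d → α) (t : Fin d) : Fin ((t : ℕ) + 1) → α :=
  fun s => x (Fin.castLE t.isLt s)

/-- A randomized algorithm `A`, given by the law `A v` of its output on each input `v`, is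
`ε`-differentially private if `P[A v ∈ S] ≤ e^ε * P[A v' ∈ S]` for all inputs `v`, `v'` and all
measurable `S`. -/
def IsDifferentiallyPrivate {D Y : Type} [MeasurableSpace Y] (ε : ℝ) (A : D → Measure Y) : Prop :=
  ∀ v v' : D, ∀ S : Set Y, MeasurableSet S →
    A v S ≤ ENNReal.ofReal (Real.exp ε) * A v' S

/-- A randomized online algorithm for one user: at each time `t` it emits a report that
depends on its private random seed and on the user's data up to time `t` only. (Past reports are
functions of the same seed and data, and "no report" may be one of the values in `Report`.) -/
structure OnlineClient (d : ℕ) where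
  Seed : Type
  [measurableSpaceSeed : MeasurableSpace Seed]
  law : Measure Seed
  [isProbabilityMeasure_law : IsProbabilityMeasure law]
  Report : Type
  [measurableSpaceReport : MeasurableSpace Report]
  report : (t : Fin d) → Seed → (Fin ((t : ℕ) + 1) → Bool) → Report
  measurable_report : ∀ (t : Fin d) (x : Fin ((t : ℕ) + 1) → Bool),
    Measurable fun ω => report t ω x

attribute [instance] OnlineClient.measurableSpaceSeed OnlineClient.isProbabilityMeasure_law
  OnlineClient.measurableSpaceReport

/-- All reports of a user with data `x` and random seed `ω`. -/
def OnlineClient.transcript {d : ℕ} (c : OnlineClient d) (x : Fin d → Bool) (ω : c.Seed) :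
    Fin d → c.Report :=
  fun t => c.report t ω (upTo x t)

/-- The law of the whole sequence of reports of a user, as a function of the user's data. -/
noncomputable def OnlineClient.mechanism {d : ℕ} (c : OnlineClient d) (k : ℕ)
    (x : UserData d k) : Measure (Fin d → c.Report) :=
  c.law.map (c.transcript x.1)

/-- An online protocol for `n` users and `d` periods: every user runs the algorithm `client`
with a random seed of their own, and at each time `t` the server computes an estimate from the
reports that it has received from the users up to time `t`. -/
structure OnlineProtocol (n d : ℕ) where
  client : OnlineClient d
  server : (t : Fin d) → (Fin n → Fin ((t : ℕ) + 1) → client.Report) → ℝ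
  measurable_server : ∀ t : Fin d, Measurable (server t)

namespace OnlineProtocol

variable {n d : ℕ}

/-- The seeds of the `n` users are independent. -/
noncomputable def seedLaw (P : OnlineProtocol n d) : Measure (Fin n → P.client.Seed) :=
  Measure.pi fun _ => P.client.law

/-- The estimate that the server outputs at time `t`. -/
def estimate {k : ℕ} (P : OnlineProtocol n d) (x : Fin n → UserData d k)
    (ω : Fin n → P.client.Seed) (t : Fin d) : ℝ :=
  P.server t fun u => upTo (P.client.transcript (x u).1 (ω u)) t

/-- Local differential privacy: the sequence of all reports of each user is produced from the
data of that user by an `ε`-differentially private algorithm. -/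
def IsLocallyDifferentiallyPrivate (P : OnlineProtocol n d) (k : ℕ) (ε : ℝ) : Prop :=
  IsDifferentiallyPrivate ε (P.client.mechanism k)

/-- `(α, β)`-accuracy: whatever the data of the users, the probability that the maximum over all
times `t` of the error of the estimates exceeds `α` is at most `β`. -/
def IsAccurate (P : OnlineProtocol n d) (k : ℕ) (α β : ℝ) : Prop :=
  ∀ x : Fin n → UserData d k,
    P.seedLaw {ω | ∃ t : Fin d, α < |P.estimate x ω t - (truth x t : ℝ)|} ≤ ENNReal.ofReal β

end OnlineProtocol

end LongitudinalLDP

namespace LongitudinalLDP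

/-! Each user draws one dyadic level `h` uniformly among about log₂ d levels and reports noisy signs
of the increments of their sequence over dyadic intervals of length `2 ^ h`. By the binary expansion
of `t`, the value at time `t` is a sum of at most one increment per level (`sum_dyadicIncr`), so the
signs, rescaled by the number of levels over their bias, estimate it without bias
(`integral_seedContribution`).

The point is to lose √k rather than k. On one level at most `k + 1` increments are nonzero. They
consume `k + 1` bits whose joint density 1 + a sin(θ Σ ±1) lies in [1 - a, 1 + a], while zero
increments consume independent fair bits. For any two inputs a bijection of the seeds matches the
transcripts (`exists_injective_response_eq`), so the likelihood ratio is at most (1 + a)/(1 - a) ≤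
e^ε, whatever `k` is. Yet for θ = 1/√(k+1) each correlated bit has mean of order a/√k (`le_bias`).

With a = ε/4 a user's contribution is thus O(log d · √k / ε), and Hoeffding's inequality with a
union bound over the `d` times gives the error bound. -/

/-- The sign `1` or `-1` encoded by a bit. -/
def sgn (b : Bool) : ℝ := if b then 1 else -1

lemma sgn_not (b : Bool) : sgn (!b) = -sgn b := by cases b <;> simp [sgn]

lemma abs_sgn (b : Bool) : |sgn b| = 1 := by cases b <;> simp [sgn]

lemma sgn_xor (b c : Bool) : sgn (b ^^ c) = sgn b * -sgn c := by
  cases b <;> cases c <;> simp [sgn]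

/-! ### Correlated bits with bounded density and bias of order 1/√K -/

/-- A density, with respect to the uniform distribution on the bits indexed by `Fin K ⊕ J`, under
which the first `K` bits are slightly correlated with each other. -/
noncomputable def tilt (K : ℕ) {J : Type} (a θ : ℝ) (w : Fin K ⊕ J → Bool) : ℝ :=
  1 + a * Real.sin (θ * ∑ i, sgn (w (Sum.inl i)))

/-- The expectation of each of the first `K` signs under the density `tilt K a θ`. -/
noncomputable def bias (K : ℕ) (a θ : ℝ) : ℝ := a * (Real.sin θ * Real.cos θ ^ (K - 1))

section Tilt

variable {K : ℕ} {J : Type} {a θ : ℝ}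

lemma tilt_le (ha : 0 ≤ a) (w : Fin K ⊕ J → Bool) : tilt K a θ w ≤ 1 + a := by
  have := mul_le_mul_of_nonneg_left (Real.sin_le_one (θ * ∑ i, sgn (w (Sum.inl i)))) ha
  unfold tilt; linarith

lemma le_tilt (ha : 0 ≤ a) (w : Fin K ⊕ J → Bool) : 1 - a ≤ tilt K a θ w := by
  have := mul_le_mul_of_nonneg_left (Real.neg_one_le_sin (θ * ∑ i, sgn (w (Sum.inl i)))) ha
  unfold tilt; linarith

variable [Fintype J] [DecidableEq J]

lemma sum_sin_eq_zero :
    ∑ w : Fin K ⊕ J → Bool, Real.sin (θ * ∑ i, sgn (w (Sum.inl i))) = 0 := by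
  have hinv : Function.Involutive fun (w : Fin K ⊕ J → Bool) i => !w i := fun w => by simp
  have h := (hinv.toPerm).sum_comp Finset.univ
    (fun w : Fin K ⊕ J → Bool => Real.sin (θ * ∑ i, sgn (w (Sum.inl i)))) (by simp)
  simp only [Function.Involutive.coe_toPerm, sgn_not, Finset.sum_neg_distrib, mul_neg,
    Real.sin_neg] at h
  linarith

lemma sum_tilt :
    ∑ w : Fin K ⊕ J → Bool, tilt K a θ w = Fintype.card (Fin K ⊕ J → Bool) := by
  simp only [tilt, Finset.sum_add_distrib, ← Finset.mul_sum, sum_sin_eq_zero]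
  simp

/-- Flipping the single bit `j` of the second block leaves the density unchanged, so that bit is
fair. -/
lemma sum_sgn_inr_mul_tilt (j : J) :
    ∑ w : Fin K ⊕ J → Bool, sgn (w (Sum.inr j)) * tilt K a θ w = 0 := by
  have hinv : Function.Involutive fun (w : Fin K ⊕ J → Bool) =>
      Function.update w (Sum.inr j) (!w (Sum.inr j)) := fun w => by simp
  have h := (hinv.toPerm).sum_comp Finset.univ
    (fun w : Fin K ⊕ J → Bool => sgn (w (Sum.inr j)) * tilt K a θ w) (by simp)
  simp only [Function.Involutive.coe_toPerm, Function.update_self, sgn_not, tilt, ne_eq,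
    reduceCtorEq, not_false_eq_true, Function.update_of_ne, neg_mul,
    Finset.sum_neg_distrib] at h
  simp only [tilt]
  linarith

lemma sum_sgn_inl (i : Fin K) :
    ∑ w : Fin K ⊕ J → Bool, sgn (w (Sum.inl i)) = 0 := by
  have hinv : Function.Involutive fun (w : Fin K ⊕ J → Bool) i => !w i := fun w => by simp
  have h := (hinv.toPerm).sum_comp Finset.univ
    (fun w : Fin K ⊕ J → Bool => sgn (w (Sum.inl i))) (by simp)
  simp only [Function.Involutive.coe_toPerm, sgn_not, Finset.sum_neg_distrib] at h
  linarith

-- The sine is the imaginary part of exp(iθΣ), which factorises over the bits: the marked bit sums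
-- to 2i sin θ, every other correlated bit to 2 cos θ, and each free bit to 2.
open Complex in
lemma sum_sgn_inl_mul_sin (i : Fin K) :
    ∑ w : Fin K ⊕ J → Bool, sgn (w (Sum.inl i)) * Real.sin (θ * ∑ i, sgn (w (Sum.inl i)))
      = Fintype.card (Fin K ⊕ J → Bool) * (Real.sin θ * Real.cos θ ^ (K - 1)) := by
  let g : Fin K ⊕ J → Bool → ℂ := fun m b => match m with
    | Sum.inl l => (if l = i then (sgn b : ℂ) else 1) * exp ((θ * sgn b : ℝ) * I)
    | Sum.inr _ => 1
  have hexp : ∀ b, exp ((θ * sgn b : ℝ) * I) = Real.cos θ + sgn b * Real.sin θ * I := by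
    intro b
    rw [exp_mul_I, ← ofReal_cos, ← ofReal_sin]
    cases b <;> simp [sgn]
  have hprod : ∀ w : Fin K ⊕ J → Bool, ∏ m, g m (w m)
      = (sgn (w (Sum.inl i)) : ℂ) * exp ((θ * ∑ l, sgn (w (Sum.inl l)) : ℝ) * I) := by
    intro w
    simp only [g, Fintype.prod_sum_type, Finset.prod_const_one, mul_one, Finset.prod_mul_distrib,
      Finset.prod_ite_eq', Finset.mem_univ, if_true, ← exp_sum]
    congr 2
    push_cast
    rw [Finset.mul_sum, Finset.sum_mul]
  have hsum : ∑ w : Fin K ⊕ J → Bool, ∏ m, g m (w m)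
      = ((2 : ℝ) ^ (K + Fintype.card J) * (Real.sin θ * Real.cos θ ^ (K - 1)) : ℝ) * I := by
    rw [← Fintype.prod_sum, Fintype.prod_sum_type]
    have h1 : ∏ j : J, ∑ b, g (Sum.inr j) b = 2 ^ Fintype.card J := by simp [g]
    have h2 : ∏ l : Fin K, ∑ b, g (Sum.inl l) b
        = (2 * Real.sin θ * I : ℂ) * (2 * Real.cos θ) ^ (K - 1) := by
      rw [← Finset.mul_prod_erase Finset.univ _ (Finset.mem_univ i)]
      congr 1
      · simp only [g, hexp, Fintype.sum_bool]
        simp [sgn]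
        ring
      · rw [Finset.prod_congr rfl (g := fun _ => (2 * Real.cos θ : ℂ))]
        · simp [Finset.card_erase_of_mem]
        · intro l hl
          simp only [g, hexp, Fintype.sum_bool, if_neg (Finset.ne_of_mem_erase hl)]
          simp [sgn]
          ring
    rw [h1, h2]
    obtain ⟨K', rfl⟩ : ∃ K', K = K' + 1 := ⟨K - 1, by have := i.isLt; omega⟩
    push_cast [Nat.add_sub_cancel]
    ring
  have him := congrArg Complex.im hsum
  rw [Finset.sum_congr rfl fun w _ => hprod w, im_sum] at him
  have hterm : ∀ w : Fin K ⊕ J → Bool,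
      ((sgn (w (Sum.inl i)) : ℂ) * exp ((θ * ∑ l, sgn (w (Sum.inl l)) : ℝ) * I)).im
        = sgn (w (Sum.inl i)) * Real.sin (θ * ∑ l, sgn (w (Sum.inl l))) := by
    intro w
    rw [im_ofReal_mul,
      exp_ofReal_mul_I_im]
  simp only [hterm] at him
  rw [him, im_ofReal_mul, I_im]
  simp

lemma sum_sgn_inl_mul_tilt (i : Fin K) :
    ∑ w : Fin K ⊕ J → Bool, sgn (w (Sum.inl i)) * tilt K a θ w
      = Fintype.card (Fin K ⊕ J → Bool) * bias K a θ := by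
  have : ∀ w : Fin K ⊕ J → Bool, sgn (w (Sum.inl i)) * tilt K a θ w = sgn (w (Sum.inl i)) +
      a * (sgn (w (Sum.inl i)) * Real.sin (θ * ∑ i, sgn (w (Sum.inl i)))) := by
    intro w; unfold tilt; ring
  simp only [this, Finset.sum_add_distrib, ← Finset.mul_sum, sum_sgn_inl, sum_sgn_inl_mul_sin,
    bias]
  ring

end Tilt

lemma le_bias {K : ℕ} (hK : 1 ≤ K) {a : ℝ} (ha : 0 ≤ a) :
    3 / 8 * a / √K ≤ bias K a (1 / √K) := by
  have hK' : (1 : ℝ) ≤ K := by exact_mod_cast hK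
  have hs : 1 ≤ √(K : ℝ) := Real.one_le_sqrt.2 hK'
  set θ : ℝ := 1 / √K with hθ
  have hθ0 : 0 < θ := by positivity
  have hθ1 : θ ≤ 1 := by rw [hθ, div_le_one (by linarith)]; exact hs
  have hθ2 : θ ^ 2 * K = 1 := by
    rw [hθ, div_pow, Real.sq_sqrt (by linarith)]; field_simp
  have hsin : 3 / 4 * θ ≤ Real.sin θ := by
    have := Real.sin_gt_sub_cube hθ0
    nlinarith [mul_pos hθ0 hθ0]
  -- Bernoulli's inequality: cos θ ≥ 1 - θ²/2, and (K - 1)θ² ≤ 1.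
  have hcos : 1 / 2 ≤ Real.cos θ ^ (K - 1) := by
    have h1 := Real.one_sub_sq_div_two_le_cos (x := θ)
    have h2 : 1 + ((K - 1 : ℕ) : ℝ) * (-(θ ^ 2 / 2)) ≤ (1 + -(θ ^ 2 / 2)) ^ (K - 1) :=
      one_add_mul_le_pow (by nlinarith) _
    have h3 : (1 + -(θ ^ 2 / 2)) ^ (K - 1) ≤ Real.cos θ ^ (K - 1) :=
      pow_le_pow_left₀ (by nlinarith) (by linarith) _
    rw [Nat.cast_sub hK] at h2
    push_cast at h2
    nlinarith
  have : 3 / 4 * θ * (1 / 2) ≤ Real.sin θ * Real.cos θ ^ (K - 1) :=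
    mul_le_mul hsin hcos (by norm_num) (by linarith [mul_pos (by norm_num : (0:ℝ) < 3/4) hθ0])
  calc 3 / 8 * a / √K = a * (3 / 4 * θ * (1 / 2)) := by rw [hθ]; ring
    _ ≤ _ := mul_le_mul_of_nonneg_left this ha

/-! ### Dyadic increments of a sequence with few changes -/

/-- The value at time `m`, with times counted from `1`, of a finite Boolean sequence; it is `0` at
time `0` and past the end. -/
def seqVal {N : ℕ} (q : Fin N → Bool) : ℕ → ℤ
  | 0 => 0
  | m + 1 => if h : m < N then (if q ⟨m, h⟩ then 1 else 0) else 0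

/-- The increment of `X` over the dyadic interval of length `2 ^ h` that ends at `m`, if `m` is an
odd multiple of `2 ^ h`; otherwise `0`. -/
def dyadicIncr (X : ℕ → ℤ) (h m : ℕ) : ℤ :=
  if m % 2 ^ (h + 1) = 2 ^ h then X m - X (m - 2 ^ h) else 0

/-- The number of times before `m` at which the level `h` dyadic increment of `X` is nonzero. -/
def dyadicRank (X : ℕ → ℤ) (h m : ℕ) : ℕ :=
  ((Finset.range m).filter fun s => dyadicIncr X h s ≠ 0).card

lemma seqVal_upTo {d : ℕ} (x : Fin d → Bool) (t : Fin d) {m : ℕ} (hm : m ≤ t + 1) :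
    seqVal (upTo x t) m = seqVal x m := by
  cases m with
  | zero => rfl
  | succ m =>
    have h1 : m < (t : ℕ) + 1 := by omega
    have h2 : m < d := by have := t.isLt; omega
    simp only [seqVal, h1, h2, dif_pos, upTo]
    rfl

lemma dyadicIncr_congr {X Y : ℕ → ℤ} {N : ℕ} (hXY : ∀ m ≤ N, X m = Y m) (h : ℕ) {m : ℕ}
    (hm : m ≤ N) : dyadicIncr X h m = dyadicIncr Y h m := by
  unfold dyadicIncr
  rw [hXY m hm, hXY (m - 2 ^ h) ((Nat.sub_le _ _).trans hm)]

lemma dyadicRank_congr {X Y : ℕ → ℤ} {N : ℕ} (hXY : ∀ m ≤ N, X m = Y m) (h : ℕ) {m : ℕ}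
    (hm : m ≤ N) : dyadicRank X h m = dyadicRank Y h m := by
  unfold dyadicRank
  congr 1
  refine Finset.filter_congr fun s hs => ?_
  rw [dyadicIncr_congr hXY h (by have := Finset.mem_range.1 hs; omega)]

lemma seqVal_eq_zero_or_one {N : ℕ} (q : Fin N → Bool) (m : ℕ) :
    seqVal q m = 0 ∨ seqVal q m = 1 := by
  cases m with
  | zero => exact Or.inl rfl
  | succ m => simp only [seqVal]; split_ifs <;> simp

lemma dyadicIncr_seqVal_eq {N : ℕ} (q : Fin N → Bool) (h m : ℕ) :
    dyadicIncr (seqVal q) h m = 0 ∨ dyadicIncr (seqVal q) h m = 1 ∨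
      dyadicIncr (seqVal q) h m = -1 := by
  unfold dyadicIncr
  split_ifs
  · rcases seqVal_eq_zero_or_one q m with h1 | h1 <;>
      rcases seqVal_eq_zero_or_one q (m - 2 ^ h) with h2 | h2 <;> simp [h1, h2]
  · exact Or.inl rfl

lemma exists_ne_pred (X : ℕ → ℤ) {p m : ℕ} (hpm : p ≤ m) (hne : X m ≠ X p) :
    ∃ s, p < s ∧ s ≤ m ∧ X s ≠ X (s - 1) := by
  induction m, hpm using Nat.le_induction with
  | base => exact absurd rfl hne
  | succ m hm ih =>
    by_cases h : X m = X p
    · exact ⟨m + 1, by omega, le_rfl, by simpa [h] using hne⟩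
    · obtain ⟨s, h1, h2, h3⟩ := ih h
      exact ⟨s, h1, by omega, h3⟩

/-- The extra 1 is the possible jump at time 1 from the conventional value 0 at time 0. -/
lemma card_seqVal_changes_le {d : ℕ} (x : Fin d → Bool) :
    ((Finset.range (d + 1)).filter fun s => seqVal x s ≠ seqVal x (s - 1)).card
      ≤ numChanges x + 1 := by
  classical
  have hsub : ((Finset.range (d + 1)).filter fun s => seqVal x s ≠ seqVal x (s - 1)) ⊆
      insert 1 ((Finset.univ.filter fun t : Fin d =>
        ∃ s : Fin d, (s : ℕ) + 1 = (t : ℕ) ∧ x s ≠ x t).image fun t : Fin d => (t : ℕ) + 1) := by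
    intro s hs
    simp only [Finset.mem_filter, Finset.mem_range] at hs
    obtain ⟨hs, hne⟩ := hs
    match s, hs, hne with
    | 0, _, hne => exact absurd rfl hne
    | 1, _, _ => simp
    | s + 2, hs, hne =>
      refine Finset.mem_insert_of_mem (Finset.mem_image.2 ⟨⟨s + 1, by omega⟩, ?_, rfl⟩)
      refine Finset.mem_filter.2 ⟨Finset.mem_univ _, ⟨s, by omega⟩, rfl, fun heq => hne ?_⟩
      have h1 : s + 1 < d := by omega
      have h2 : s < d := by omega
      simp [seqVal, h1, h2, heq]
  refine (Finset.card_le_card hsub).trans ((Finset.card_insert_le _ _).trans ?_)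
  exact Nat.add_le_add_right Finset.card_image_le 1

/-- A nonzero increment forces a change inside its interval, and rounding that change up to a
multiple of `2 ^ h` recovers the right end of the interval. -/
lemma card_dyadicIncr_ne_zero_le (X : ℕ → ℤ) (h N : ℕ) :
    ((Finset.range N).filter fun m => dyadicIncr X h m ≠ 0).card
      ≤ ((Finset.range N).filter fun s => X s ≠ X (s - 1)).card := by
  classical
  have hsub : ((Finset.range N).filter fun m => dyadicIncr X h m ≠ 0) ⊆
      ((Finset.range N).filter fun s => X s ≠ X (s - 1)).image
        fun s => (s + 2 ^ h - 1) / 2 ^ h * 2 ^ h := by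
    intro m hm
    obtain ⟨hmN, hne⟩ := Finset.mem_filter.1 hm
    rw [Finset.mem_range] at hmN
    unfold dyadicIncr at hne
    split_ifs at hne with hmod
    · have hpos : 0 < 2 ^ h := by positivity
      obtain ⟨s, hs1, hs2, hs3⟩ := exists_ne_pred X (Nat.sub_le m (2 ^ h))
        (fun he => hne (by rw [he, sub_self]))
      refine Finset.mem_image.2 ⟨s, Finset.mem_filter.2 ⟨Finset.mem_range.2 (by omega), hs3⟩, ?_⟩
      obtain ⟨q, hq⟩ : 2 ^ h ∣ m := by
        have hd : 2 ^ h ∣ 2 ^ (h + 1) := pow_dvd_pow 2 (Nat.le_succ h)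
        rw [← Nat.mod_add_div m (2 ^ (h + 1)), hmod]
        exact dvd_add dvd_rfl (hd.mul_right _)
      have hq' : (s + 2 ^ h - 1) / 2 ^ h = q := by
        rw [Nat.div_eq_iff hpos, mul_comm, ← hq]
        constructor <;> omega
      rw [hq', hq, mul_comm]
    · exact absurd rfl hne
  exact (Finset.card_le_card hsub).trans Finset.card_image_le

lemma dyadicRank_lt_dyadicRank {X : ℕ → ℤ} {h m m' : ℕ} (hm : dyadicIncr X h m ≠ 0)
    (hlt : m < m') : dyadicRank X h m < dyadicRank X h m' := by
  refine Finset.card_lt_card (Finset.ssubset_iff_of_subset ?_ |>.2 ⟨m, ?_, ?_⟩)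
  · exact Finset.filter_subset_filter _ (Finset.range_subset_range.2 hlt.le)
  · simp [hlt, hm]
  · simp

lemma dyadicRank_lt {d k : ℕ} (x : UserData d k) {h m : ℕ} (hmd : m ≤ d)
    (hm : dyadicIncr (seqVal x.1) h m ≠ 0) : dyadicRank (seqVal x.1) h m < k + 1 :=
  calc dyadicRank (seqVal x.1) h m < dyadicRank (seqVal x.1) h (d + 1) :=
        dyadicRank_lt_dyadicRank hm (by omega)
    _ ≤ _ := card_dyadicIncr_ne_zero_le _ _ _
    _ ≤ _ := card_seqVal_changes_le _
    _ ≤ k + 1 := Nat.add_le_add_right x.2 1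

/-- The largest multiple of `2 ^ h` that is at most `T`. -/
def dyadicFloor (h T : ℕ) : ℕ := T / 2 ^ h * 2 ^ h

lemma dyadicFloor_le (h T : ℕ) : dyadicFloor h T ≤ T := Nat.div_mul_le_self _ _

/-- The two floors coincide when binary digit `h` of `T` is 0; otherwise they bound one dyadic
interval ending at an odd multiple of `2 ^ h`. -/
lemma dyadicFloor_sub_succ (X : ℕ → ℤ) (h T : ℕ) :
    X (dyadicFloor h T) - X (dyadicFloor (h + 1) T)
      = if T / 2 ^ h % 2 = 1 then dyadicIncr X h (dyadicFloor h T) else 0 := by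
  have hpos : 0 < 2 ^ h := by positivity
  have hdiv : T / 2 ^ (h + 1) = T / 2 ^ h / 2 := by rw [pow_succ, Nat.div_div_eq_div_mul]
  unfold dyadicFloor
  rw [hdiv]
  set q := T / 2 ^ h
  split_ifs with hq
  · have h1 : q * 2 ^ h % 2 ^ (h + 1) = 2 ^ h := by
      rw [pow_succ, mul_comm q, Nat.mul_mod_mul_left, hq, mul_one]
    have h2 : q / 2 * 2 ^ (h + 1) = q * 2 ^ h - 2 ^ h := by
      have : q = 2 * (q / 2) + 1 := by omega
      conv_rhs => rw [this]
      rw [pow_succ, add_mul, one_mul, Nat.add_sub_cancel]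
      ring
    rw [dyadicIncr, if_pos h1, h2]
  · have : q = 2 * (q / 2) := by omega
    have h2 : q / 2 * 2 ^ (h + 1) = q * 2 ^ h := by
      conv_rhs => rw [this]
      rw [pow_succ]
      ring
    rw [h2, sub_self]

lemma sum_dyadicIncr (X : ℕ → ℤ) {H T : ℕ} (hT : T < 2 ^ H) :
    ∑ h : Fin H, (if T / 2 ^ (h : ℕ) % 2 = 1 then dyadicIncr X h (dyadicFloor h T) else 0)
      = X T - X 0 := by
  rw [Fin.sum_univ_eq_sum_range
    (fun h => if T / 2 ^ h % 2 = 1 then dyadicIncr X h (dyadicFloor h T) else 0)]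
  simp only [← dyadicFloor_sub_succ]
  rw [Finset.sum_range_sub' (fun h => X (dyadicFloor h T))]
  simp [dyadicFloor, Nat.div_eq_of_lt hT]

/-! ### Responses and the coupling between two inputs -/

/-- The random bit used at time `t + 1` on level `h`: a fresh correlated bit if the dyadic
increment is nonzero, and an independent unbiased bit otherwise. -/
def slot (k d : ℕ) (X : ℕ → ℤ) (h : ℕ) (t : Fin d) : Fin (k + 1) ⊕ Fin d :=
  if dyadicIncr X h (t + 1) = 0 then Sum.inr t
  else Sum.inl (Fin.ofNat (k + 1) (dyadicRank X h (t + 1)))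

/-- The bit reported at time `t + 1` on level `h`: the random bit in the slot of `t`, flipped if the
dyadic increment is negative. -/
def response (k d : ℕ) (X : ℕ → ℤ) (h : ℕ) (w : Fin (k + 1) ⊕ Fin d → Bool) (t : Fin d) : Bool :=
  w (slot k d X h t) ^^ decide (dyadicIncr X h (t + 1) < 0)

/-- No random bit is used twice: ranks strictly increase along nonzero increments and stay below `k
+ 1`, so the reduction in `Fin.ofNat` changes nothing. -/
lemma slot_injective {d k : ℕ} (x : UserData d k) (h : ℕ) :
    Function.Injective (slot k d (seqVal x.1) h) := by
  have hlt : ∀ s t : Fin d, s < t → slot k d (seqVal x.1) h s ≠ slot k d (seqVal x.1) h t := by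
    intro s t hst heq
    unfold slot at heq
    split_ifs at heq with h1 h2 h2
    · exact hst.ne (Sum.inr.inj heq)
    · have hval := congrArg Fin.val (Sum.inl.inj heq)
      have hs := dyadicRank_lt x (by omega) h1
      have ht := dyadicRank_lt x (by omega) h2
      simp only [Fin.ofNat, Nat.mod_eq_of_lt hs, Nat.mod_eq_of_lt ht] at hval
      have := dyadicRank_lt_dyadicRank h1 (Nat.add_lt_add_right hst 1)
      omega
  intro s t heq
  rcases lt_trichotomy s t with hst | hst | hst
  · exact absurd heq (hlt s t hst)
  · exact hst
  · exact absurd heq.symm (hlt t s hst)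

/-- The response needs only the past, which makes the algorithm online. -/
lemma response_congr {k d : ℕ} {X Y : ℕ → ℤ} {t : Fin d} (hXY : ∀ m ≤ (t : ℕ) + 1, X m = Y m)
    (h : ℕ) (w : Fin (k + 1) ⊕ Fin d → Bool) : response k d X h w t = response k d Y h w t := by
  unfold response slot
  rw [dyadicIncr_congr hXY h le_rfl, dyadicRank_congr hXY h le_rfl]

lemma exists_injective_response_eq {d k : ℕ} (x x' : UserData d k) (h : ℕ) :
    ∃ τ : (Fin (k + 1) ⊕ Fin d → Bool) → (Fin (k + 1) ⊕ Fin d → Bool), Function.Injective τ ∧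
      ∀ w, response k d (seqVal x'.1) h (τ w) = response k d (seqVal x.1) h w := by
  -- `σ` carries the slots used by `x'` to those used by `x`; the mask `c` then corrects the times
  -- at which the two sign flips differ.
  obtain ⟨σ, hσ⟩ := Equiv.Perm.exists_extending_pair _ _ (slot_injective x' h) (slot_injective x h)
  let c : Fin (k + 1) ⊕ Fin d → Bool := Function.extend (slot k d (seqVal x'.1) h)
    (fun t => decide (dyadicIncr (seqVal x.1) h (t + 1) < 0) ^^
      decide (dyadicIncr (seqVal x'.1) h (t + 1) < 0)) fun _ => false
  refine ⟨fun w i => w (σ i) ^^ c i, fun w w' hw => ?_, fun w => ?_⟩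
  · funext i
    have := congrFun hw (σ.symm i)
    simpa using this
  · funext t
    have h1 : σ (slot k d (seqVal x'.1) h t) = slot k d (seqVal x.1) h t := hσ t
    simp only [response, h1, c, (slot_injective x' h).extend_apply]
    simp

/-- A zero increment reads a fair bit; otherwise the flip turns the common bias into one with the
sign of the increment. So the mean is linear in the increment. -/
lemma sum_sgn_response_mul_tilt {k d : ℕ} {N : ℕ} (q : Fin N → Bool) (h : ℕ) (t : Fin d)
    (a θ : ℝ) :
    ∑ w, sgn (response k d (seqVal q) h w t) * tilt (k + 1) a θ w
      = Fintype.card (Fin (k + 1) ⊕ Fin d → Bool) *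
        (bias (k + 1) a θ * dyadicIncr (seqVal q) h (t + 1)) := by
  have hfact : ∀ w : Fin (k + 1) ⊕ Fin d → Bool,
      sgn (response k d (seqVal q) h w t) * tilt (k + 1) a θ w =
        -sgn (decide (dyadicIncr (seqVal q) h (t + 1) < 0)) *
          (sgn (w (slot k d (seqVal q) h t)) * tilt (k + 1) a θ w) := by
    intro w; rw [response, sgn_xor]; ring
  rw [Finset.sum_congr rfl fun w _ => hfact w, ← Finset.mul_sum]
  unfold slot
  rcases dyadicIncr_seqVal_eq q h (t + 1) with hv | hv | hv
  · simp [hv, sum_sgn_inr_mul_tilt]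
  · rw [if_neg (by simp [hv]), sum_sgn_inl_mul_tilt]
    simp [hv, sgn]
  · rw [if_neg (by simp [hv]), sum_sgn_inl_mul_tilt]
    simp [hv, sgn]

/-! ### The client and its privacy -/

/-- A seed: a level, and bits indexed by the slots. -/
abbrev Seed (L k d : ℕ) : Type := Fin (L + 1) × (Fin (k + 1) ⊕ Fin d → Bool)

section

variable {L k d : ℕ} {a : ℝ}

/-- The distribution of the seeds: the level is uniform, and the bits have density `tilt`. -/
noncomputable def seedPMF (L k d : ℕ) (θ : ℝ) (ha : 0 ≤ a) (ha1 : a ≤ 1) : PMF (Seed L k d) :=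
  PMF.ofFintype
    (fun ω => ENNReal.ofReal (tilt (k + 1) a θ ω.2 / Fintype.card (Seed L k d))) <| by
      have hnn : ∀ w : Fin (k + 1) ⊕ Fin d → Bool, 0 ≤ tilt (k + 1) a θ w := fun w => by
        linarith [le_tilt (θ := θ) ha w]
      rw [← ENNReal.ofReal_sum_of_nonneg fun ω _ => div_nonneg (hnn _) (Nat.cast_nonneg _),
        ← Finset.sum_div, Fintype.sum_prod_type]
      simp only [sum_tilt]
      rw [Fintype.card_prod, Nat.cast_mul]
      simp only [Finset.sum_const, Finset.card_univ, nsmul_eq_mul]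
      rw [div_self, ENNReal.ofReal_one]
      exact mul_ne_zero (Nat.cast_ne_zero.2 Fintype.card_ne_zero)
        (Nat.cast_ne_zero.2 Fintype.card_ne_zero)

lemma seedPMF_toReal (θ : ℝ) (ha : 0 ≤ a) (ha1 : a ≤ 1) (ω : Seed L k d) :
    (seedPMF L k d θ ha ha1 ω).toReal = tilt (k + 1) a θ ω.2 / Fintype.card (Seed L k d) :=
  ENNReal.toReal_ofReal <| div_nonneg (by linarith [le_tilt (θ := θ) ha ω.2]) (Nat.cast_nonneg _)

lemma seedPMF_le_mul (θ : ℝ) (ha : 0 ≤ a) (ha1 : a ≤ 1) {r : ℝ} (hr : 0 ≤ r)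
    (har : 1 + a ≤ r * (1 - a)) (ω ω' : Seed L k d) :
    seedPMF L k d θ ha ha1 ω ≤ ENNReal.ofReal r * seedPMF L k d θ ha ha1 ω' := by
  simp only [seedPMF, PMF.ofFintype_apply]
  rw [← ENNReal.ofReal_mul hr, ← mul_div_assoc]
  refine ENNReal.ofReal_le_ofReal (div_le_div_of_nonneg_right ?_ (Nat.cast_nonneg _))
  exact (tilt_le ha _).trans (har.trans (mul_le_mul_of_nonneg_left (le_tilt ha _) hr))

/-- The client that reports its level and the response for that level. -/
noncomputable def dyadicClient (L k d : ℕ) (θ : ℝ) (ha : 0 ≤ a) (ha1 : a ≤ 1) :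
    OnlineClient d where
  Seed := Seed L k d
  law := (seedPMF L k d θ ha ha1).toMeasure
  Report := Fin (L + 1) × Bool
  report t ω q := (ω.1, response k d (seqVal q) ω.1 ω.2 t)
  measurable_report _ _ := Measurable.of_discrete

lemma dyadicClient_transcript (θ : ℝ) (ha : 0 ≤ a) (ha1 : a ≤ 1) (x : Fin d → Bool)
    (ω : Seed L k d) (t : Fin d) :
    (dyadicClient L k d θ ha ha1).transcript x ω t = (ω.1, response k d (seqVal x) ω.1 ω.2 t) := by
  simp only [OnlineClient.transcript, dyadicClient]
  rw [response_congr fun m hm => seqVal_upTo x t hm]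

lemma measurable_dyadicClient_transcript (θ : ℝ) (ha : 0 ≤ a) (ha1 : a ≤ 1) (x : Fin d → Bool) :
    Measurable ((dyadicClient L k d θ ha ha1).transcript x) :=
  measurable_pi_lambda _ fun t => (dyadicClient L k d θ ha ha1).measurable_report t _

lemma isDifferentiallyPrivate_dyadicClient (θ : ℝ) (ha : 0 ≤ a) (ha1 : a ≤ 1) {ε : ℝ}
    (hε : 1 + a ≤ Real.exp ε * (1 - a)) :
    IsDifferentiallyPrivate ε ((dyadicClient L k d θ ha ha1).mechanism k) := by
  intro x x' S hS
  choose τ hτ hresp using fun h : Fin (L + 1) => exists_injective_response_eq x x' h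
  let T : UserData d k → Seed L k d → Fin d → Fin (L + 1) × Bool :=
    fun x => (dyadicClient L k d θ ha ha1).transcript x.1
  -- The coupling preserves the level, which is itself reported, and recodes the bits level by
  -- level.
  let φ : Seed L k d → Seed L k d := fun ω => (ω.1, τ ω.1 ω.2)
  have hφ : Function.Bijective φ := by
    refine Finite.injective_iff_bijective.1 ?_
    rintro ⟨h, w⟩ ⟨h', w'⟩ heq
    obtain rfl : h = h' := congrArg Prod.fst heq
    exact Prod.ext rfl (hτ h (congrArg Prod.snd heq))
  have hT : ∀ ω, T x' (φ ω) = T x ω := by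
    intro ω
    funext t
    simp only [T, dyadicClient_transcript, φ, hresp]
  have hlaw : ∀ x, (dyadicClient L k d θ ha ha1).mechanism k x S
      = ∑ ω, (T x ⁻¹' S).indicator (seedPMF L k d θ ha ha1) ω := by
    intro x
    rw [OnlineClient.mechanism, Measure.map_apply (measurable_dyadicClient_transcript _ _ _ _) hS]
    exact PMF.toMeasure_apply_fintype _ _
  rw [hlaw, hlaw, Finset.mul_sum, ← hφ.sum_comp
    fun ω => ENNReal.ofReal (Real.exp ε) * (T x' ⁻¹' S).indicator (seedPMF L k d θ ha ha1) ω]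
  refine Finset.sum_le_sum fun ω _ => ?_
  by_cases hω : T x ω ∈ S
  · have hω' : T x' (φ ω) ∈ S := by rwa [hT]
    rw [Set.indicator_of_mem (by exact hω), Set.indicator_of_mem (by exact hω')]
    exact seedPMF_le_mul θ ha ha1 (Real.exp_pos _).le hε _ _
  · rw [Set.indicator_of_notMem (by exact hω)]
    exact zero_le

/-! ### The server and its unbiasedness -/

/-- The contribution of one user, whose reports up to time `t + 1` are `r`, to the estimate at that
time, where `c` is the bias of the responses. -/
noncomputable def contribution (L : ℕ) (c : ℝ) (t : ℕ) (r : Fin (t + 1) → Fin (L + 1) × Bool) :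
    ℝ :=
  if (t + 1) / 2 ^ ((r 0).1 : ℕ) % 2 = 1 then
    (L + 1) / c * sgn (r (Fin.ofNat (t + 1) (dyadicFloor (r 0).1 (t + 1) - 1))).2
  else 0

lemma abs_contribution_le {c : ℝ} (hc : 0 < c) (t : ℕ) (r : Fin (t + 1) → Fin (L + 1) × Bool) :
    |contribution L c t r| ≤ (L + 1) / c := by
  have : (0 : ℝ) ≤ (L + 1) / c := by positivity
  unfold contribution
  split_ifs
  · rw [abs_mul, abs_sgn, mul_one, abs_of_nonneg this]
  · simpa using this

/-- The protocol in which the server adds up the contributions of the users. -/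
noncomputable def dyadicProtocol (n L k d : ℕ) (θ : ℝ) (ha : 0 ≤ a) (ha1 : a ≤ 1) :
    OnlineProtocol n d where
  client := dyadicClient L k d θ ha ha1
  server t r := ∑ u, contribution L (bias (k + 1) a θ) t (r u)
  measurable_server t := by
    refine Finset.measurable_sum _ fun u _ => ?_
    have : Measurable fun r : Fin ((t : ℕ) + 1) → Fin (L + 1) × Bool =>
      contribution L (bias (k + 1) a θ) t r := Measurable.of_discrete
    exact this.comp (measurable_pi_apply u)

/-- The contribution at time `t + 1` of a user with data `x` and seed `ω`. -/
noncomputable def seedContribution (L k : ℕ) (c : ℝ) (x : Fin d → Bool) (t : Fin d)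
    (ω : Seed L k d) : ℝ :=
  contribution L c t
    (upTo (fun s => (ω.1, response k d (seqVal x) ω.1 ω.2 s)) t)

lemma dyadicProtocol_estimate {n : ℕ} (θ : ℝ) (ha : 0 ≤ a) (ha1 : a ≤ 1)
    (x : Fin n → UserData d k) (ω : Fin n → Seed L k d) (t : Fin d) :
    (dyadicProtocol n L k d θ ha ha1).estimate x ω t
      = ∑ u, seedContribution L k (bias (k + 1) a θ) (x u).1 t (ω u) := by
  have : ∀ u, (dyadicClient L k d θ ha ha1).transcript (x u).1 (ω u)
      = fun s => ((ω u).1, response k d (seqVal (x u).1) (ω u).1 (ω u).2 s) :=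
    fun u => funext fun s => dyadicClient_transcript θ ha ha1 _ _ s
  simp only [seedContribution, ← this]
  rfl

lemma seedContribution_eq (c : ℝ) (x : Fin d → Bool) (t : Fin d) (ω : Seed L k d)
    (hodd : ((t : ℕ) + 1) / 2 ^ (ω.1 : ℕ) % 2 = 1) :
    ∃ s : Fin d, (s : ℕ) + 1 = dyadicFloor ω.1 (t + 1) ∧ ∀ w, seedContribution L k c x t (ω.1, w) =
      (L + 1) / c * sgn (response k d (seqVal x) ω.1 w s) := by
  have h1 : dyadicFloor ω.1 (t + 1) ≤ t + 1 := dyadicFloor_le _ _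
  -- Reports are indexed from 0 and times from 1; the odd digit makes the floor positive, so
  -- subtracting 1 does not truncate.
  have h2 : 0 < dyadicFloor ω.1 (t + 1) := by
    refine Nat.mul_pos (Nat.pos_of_ne_zero fun h0 => ?_) (by positivity)
    simp [h0] at hodd
  refine ⟨⟨dyadicFloor ω.1 (t + 1) - 1, by omega⟩, by simp only; omega, fun w => ?_⟩
  have h3 : (dyadicFloor ω.1 (t + 1) - 1) % (t + 1) = dyadicFloor ω.1 (t + 1) - 1 :=
    Nat.mod_eq_of_lt (by omega)
  simp only [seedContribution, contribution, upTo, if_pos hodd, Fin.ofNat, Fin.castLE, h3]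

lemma sum_seedContribution (θ : ℝ) (x : Fin d → Bool) (t : Fin d) (hc : bias (k + 1) a θ ≠ 0)
    (hL : d < 2 ^ (L + 1)) :
    ∑ ω, seedContribution L k (bias (k + 1) a θ) x t ω * tilt (k + 1) a θ ω.2
      = Fintype.card (Seed L k d) * (if x t then 1 else 0) := by
  have hinner : ∀ h : Fin (L + 1), ∑ w, seedContribution L k (bias (k + 1) a θ) x t (h, w) *
      tilt (k + 1) a θ w = Fintype.card (Fin (k + 1) ⊕ Fin d → Bool) * (L + 1) *
        ((if ((t : ℕ) + 1) / 2 ^ (h : ℕ) % 2 = 1 then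
          dyadicIncr (seqVal x) h (dyadicFloor h (t + 1)) else 0 : ℤ) : ℝ) := by
    intro h
    split_ifs with hodd
    · obtain ⟨s, hs, hw⟩ := seedContribution_eq (L := L) (k := k) (bias (k + 1) a θ) x t
        (h, fun _ => true) hodd
      simp only at hs hw
      simp only [hw, mul_assoc, ← Finset.mul_sum]
      rw [sum_sgn_response_mul_tilt, hs]
      field_simp
    · simp [seedContribution, contribution, upTo, hodd]
  rw [Fintype.sum_prod_type]
  simp only [hinner]
  rw [← Finset.mul_sum, ← Int.cast_sum, sum_dyadicIncr (seqVal x) (by omega)]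
  simp only [seqVal, Fin.is_lt, dif_pos, Fin.eta, sub_zero, Fintype.card_prod, Fintype.card_fin,
    Nat.cast_mul]
  push_cast
  ring

lemma integral_seedContribution (θ : ℝ) (ha : 0 ≤ a) (ha1 : a ≤ 1) (x : Fin d → Bool) (t : Fin d)
    (hc : bias (k + 1) a θ ≠ 0) (hL : d < 2 ^ (L + 1)) :
    ∫ ω, seedContribution L k (bias (k + 1) a θ) x t ω ∂(seedPMF L k d θ ha ha1).toMeasure
      = if x t then 1 else 0 := by
  have hcard : (Fintype.card (Seed L k d) : ℝ) ≠ 0 := Nat.cast_ne_zero.2 Fintype.card_ne_zero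
  rw [PMF.integral_eq_sum]
  simp only [seedPMF_toReal, smul_eq_mul]
  rw [← mul_right_inj' hcard, ← sum_seedContribution θ x t hc hL, Finset.mul_sum]
  refine Finset.sum_congr rfl fun ω _ => ?_
  field_simp

end

/-! ### Concentration and constants -/

open ProbabilityTheory in
lemma measure_pi_abs_sum_sub_integral_gt_le {Ω : Type} [MeasurableSpace Ω] (μ : Measure Ω)
    [IsProbabilityMeasure μ] {n : ℕ} {Z : Fin n → Ω → ℝ} (hZ : ∀ u, Measurable (Z u)) {B : ℝ}
    (hB : ∀ u ω, |Z u ω| ≤ B) {α : ℝ} (hα : 0 ≤ α) :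
    Measure.pi (fun _ : Fin n => μ) {ω | α < |∑ u, Z u (ω u) - ∑ u, ∫ ω, Z u ω ∂μ|}
      ≤ ENNReal.ofReal (2 * Real.exp (-α ^ 2 / (2 * (n * B ^ 2)))) := by
  set P : Measure (Fin n → Ω) := Measure.pi fun _ : Fin n => μ
  have htail : ∀ Y : Fin n → Ω → ℝ, (∀ u, Measurable (Y u)) → (∀ u ω, |Y u ω| ≤ B) →
      P.real {ω | α ≤ ∑ u, (Y u (ω u) - ∫ ω, Y u ω ∂μ)} ≤
        Real.exp (-α ^ 2 / (2 * (n * B ^ 2))) := by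
    intro Y hY hYB
    have hindep : iIndepFun (fun u (ω : Fin n → Ω) => Y u (ω u) - ∫ ω, Y u ω ∂μ) P :=
      iIndepFun_pi (X := fun u ω => Y u ω - ∫ ω, Y u ω ∂μ)
        fun u => ((hY u).sub_const _).aemeasurable
    have hsub : ∀ u ∈ Finset.univ, HasSubgaussianMGF
        (fun ω : Fin n → Ω => Y u (ω u) - ∫ ω, Y u ω ∂μ) ((‖B - -B‖₊ / 2) ^ 2) P := by
      intro u _
      have hint : ∫ ω, Y u ω ∂μ = ∫ ω, Y u (ω u) ∂P := by
        rw [← (measurePreserving_eval (fun _ : Fin n => μ) u).map_eq,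
          integral_map (measurable_pi_apply u).aemeasurable (hY u).aestronglyMeasurable]
      rw [hint]
      exact hasSubgaussianMGF_of_mem_Icc ((hY u).comp (measurable_pi_apply u)).aemeasurable
        (.of_forall fun ω => abs_le.1 (hYB u (ω u)))
    refine (HasSubgaussianMGF.measure_sum_ge_le_of_iIndepFun hindep hsub hα).trans_eq ?_
    congr 3
    simp only [Finset.sum_const, Finset.card_univ, Fintype.card_fin, nsmul_eq_mul,
      NNReal.coe_mul, NNReal.coe_natCast, NNReal.coe_pow, NNReal.coe_div, coe_nnnorm,
      Real.norm_eq_abs, NNReal.coe_ofNat]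
    rw [div_pow, sq_abs]
    ring
  have h1 := htail Z hZ hB
  have h2 := htail (fun u ω => -Z u ω) (fun u => (hZ u).neg) (by simpa using hB)
  have hsubset : {ω : Fin n → Ω | α < |∑ u, Z u (ω u) - ∑ u, ∫ ω, Z u ω ∂μ|} ⊆
      {ω | α ≤ ∑ u, (Z u (ω u) - ∫ ω, Z u ω ∂μ)} ∪
        {ω | α ≤ ∑ u, (-Z u (ω u) - ∫ ω, -Z u ω ∂μ)} := by
    intro ω hω
    simp only [Set.mem_union, Set.mem_ofPred_eq, integral_neg, Finset.sum_sub_distrib,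
      Finset.sum_neg_distrib] at hω ⊢
    rcases lt_abs.1 hω with h | h
    · exact Or.inl h.le
    · right; linarith
  rw [← ofReal_measureReal (measure_ne_top _ _)]
  refine ENNReal.ofReal_le_ofReal ((measureReal_mono hsubset).trans
    ((measureReal_union_le _ _).trans ?_))
  linarith

lemma cast_truth {n d k : ℕ} (x : Fin n → UserData d k) (t : Fin d) :
    (truth x t : ℝ) = ∑ u, if (x u).1 t then 1 else 0 := by
  simp [truth]

lemma measure_dyadicProtocol_error_le {n L k d : ℕ} {a θ : ℝ} (ha : 0 ≤ a) (ha1 : a ≤ 1)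
    (hc : 0 < bias (k + 1) a θ) (hL : d < 2 ^ (L + 1)) (x : Fin n → UserData d k) (t : Fin d)
    {α : ℝ} (hα : 0 ≤ α) :
    (dyadicProtocol n L k d θ ha ha1).seedLaw
        {ω | α < |(dyadicProtocol n L k d θ ha ha1).estimate x ω t - (truth x t : ℝ)|}
      ≤ ENNReal.ofReal
        (2 * Real.exp (-α ^ 2 / (2 * (n * ((L + 1) / bias (k + 1) a θ) ^ 2)))) := by
  have h := measure_pi_abs_sum_sub_integral_gt_le (seedPMF L k d θ ha ha1).toMeasure
    (Z := fun u => seedContribution L k (bias (k + 1) a θ) (x u).1 t)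
    (fun u => Measurable.of_discrete) (fun u ω => abs_contribution_le hc _ _) hα
  simp only [integral_seedContribution θ ha ha1 _ t hc.ne' hL] at h
  rw [← cast_truth] at h
  simp only [← dyadicProtocol_estimate θ ha ha1] at h
  exact h

lemma natLog_add_one_le {d : ℕ} (hd : 2 ≤ d) : (Nat.log 2 d + 1 : ℝ) ≤ 2 * Real.logb 2 d := by
  have h1 : (1 : ℝ) ≤ Nat.log 2 d := by exact_mod_cast Nat.log_pos (by norm_num) hd
  have h2 := Real.natLog_le_logb d 2
  push_cast at h2
  linarith

lemma dyadicProtocol_scale_le {d k : ℕ} {ε : ℝ} (hd : 2 ≤ d) (hk : 1 ≤ k) (hε : 0 < ε) :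
    ((Nat.log 2 d + 1 : ℕ) : ℝ) / bias (k + 1) (ε / 4) (1 / √((k + 1 : ℕ) : ℝ))
      ≤ 32 * (Real.logb 2 d / ε * √k) := by
  have hlog := natLog_add_one_le hd
  have hb := le_bias (K := k + 1) (by omega) (a := ε / 4) (by positivity)
  have hk' : (1 : ℝ) ≤ k := by exact_mod_cast hk
  have hsq : √((k + 1 : ℕ) : ℝ) ≤ 3 / 2 * √(k : ℝ) := by
    refine Real.sqrt_le_iff.2 ⟨by positivity, ?_⟩
    rw [mul_pow, Real.sq_sqrt (by linarith)]
    push_cast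
    linarith
  have hspos : 0 < √((k + 1 : ℕ) : ℝ) := Real.sqrt_pos.2 (by positivity)
  have hkpos : 0 < √(k : ℝ) := Real.sqrt_pos.2 (by linarith)
  -- The constant 16 comes from 3/8 · 1/4 divided by 3/2; the factor 2 for the number of levels then
  -- gives 32.
  have hb' : ε / (16 * √(k : ℝ)) ≤ bias (k + 1) (ε / 4) (1 / √((k + 1 : ℕ) : ℝ)) := by
    refine le_trans ?_ hb
    rw [div_le_div_iff₀ (by positivity) hspos]
    nlinarith
  calc _ ≤ 2 * Real.logb 2 d / (ε / (16 * √(k : ℝ))) :=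
        div_le_div₀ (by linarith [Nat.cast_nonneg (α := ℝ) (Nat.log 2 d)])
          (by push_cast; exact hlog) (by positivity) hb'
    _ = _ := by field_simp; ring

end LongitudinalLDP

theorem theorem1 :
    ∃ C : ℝ, 0 < C ∧
      ∀ (n d k : ℕ) (ε β : ℝ), 2 ≤ d → 1 ≤ k → 0 < ε → ε ≤ 1 → 0 < β → β < 1 →
        ε⁻¹ * Real.logb 2 (d : ℝ) * √((k : ℝ) * Real.log ((d : ℝ) / β)) ≤ √(n : ℝ) →
        ∃ P : LongitudinalLDP.OnlineProtocol n d,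
          P.IsLocallyDifferentiallyPrivate k ε ∧
          P.IsAccurate k
            (C * (Real.logb 2 (d : ℝ) / ε * √((k : ℝ) * (n : ℝ) * Real.log ((d : ℝ) / β)))) β := by
  open LongitudinalLDP in
  -- 64 is twice the 32 of `dyadicProtocol_scale_le`, which makes the Hoeffding exponent at least 2
  -- ln(d/β).
  refine ⟨64, by norm_num, fun n d k ε β hd hk hε hε1 hβ hβ1 _ => ?_⟩
  have ha : (0 : ℝ) ≤ ε / 4 := by positivity
  have ha1 : ε / 4 ≤ 1 := by linarith
  have hd' : (2 : ℝ) ≤ d := by exact_mod_cast hd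
  set θ : ℝ := 1 / √((k + 1 : ℕ) : ℝ) with hθ
  -- Since e^ε ≥ 1 + ε, it suffices that ε²/4 ≤ ε/2.
  have hexp : 1 + ε / 4 ≤ Real.exp ε * (1 - ε / 4) := by
    nlinarith [mul_le_mul_of_nonneg_right (Real.add_one_le_exp ε) (sub_nonneg.2 ha1)]
  have hc : 0 < bias (k + 1) (ε / 4) θ :=
    lt_of_lt_of_le (by positivity) (le_bias (by omega) ha)
  refine ⟨dyadicProtocol n (Nat.log 2 d) k d θ ha ha1,
    isDifferentiallyPrivate_dyadicClient θ ha ha1 hexp, fun x => ?_⟩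
  set α : ℝ := 64 * (Real.logb 2 (d : ℝ) / ε * √((k : ℝ) * (n : ℝ) * Real.log ((d : ℝ) / β)))
    with hα
  have hlogb : 0 < Real.logb 2 (d : ℝ) := Real.logb_pos (by norm_num) (by linarith)
  have hdβ : 1 < d / β := by rw [lt_div_iff₀ hβ]; linarith
  have hlog : 0 < Real.log (d / β) := Real.log_pos hdβ
  have hα0 : 0 ≤ α := by positivity
  -- For `n = 0` the tail bound degenerates through division by zero, but estimate and truth are
  -- both empty sums.
  rcases Nat.eq_zero_or_pos n with rfl | hn
  · have hempty : {ω | ∃ t, α < |(dyadicProtocol 0 (Nat.log 2 d) k d θ ha ha1).estimate x ω t -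
        (truth x t : ℝ)|} = ∅ := by
      refine Set.eq_empty_of_forall_notMem fun ω hω => ?_
      obtain ⟨t, ht⟩ := hω
      rw [cast_truth, dyadicProtocol_estimate θ ha ha1 x ω t] at ht
      simp at ht
      linarith
    rw [hempty, measure_empty]
    exact zero_le
  have hn' : (0 : ℝ) < n := by exact_mod_cast hn
  have hscale := dyadicProtocol_scale_le hd hk hε
  rw [← hθ] at hscale
  set B : ℝ := ((Nat.log 2 d + 1 : ℕ) : ℝ) / bias (k + 1) (ε / 4) θ with hB
  have hB0 : 0 < B := by positivity
  have htail : 2 * Real.exp (-α ^ 2 / (2 * (n * B ^ 2))) ≤ β / d := by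
    have hα2 : 2 * Real.log (d / β) * (2 * (n * B ^ 2)) ≤ α ^ 2 := by
      have hB2 : B ^ 2 ≤ (32 * (Real.logb 2 d / ε * √k)) ^ 2 :=
        pow_le_pow_left₀ hB0.le hscale 2
      have hk0 : (0 : ℝ) ≤ k := Nat.cast_nonneg k
      have hsq : √((k : ℝ) * n * Real.log (d / β)) ^ 2 = k * n * Real.log (d / β) :=
        Real.sq_sqrt (by positivity)
      rw [mul_pow, mul_pow, Real.sq_sqrt hk0] at hB2
      rw [hα, mul_pow, mul_pow, hsq]
      calc _ = 4 * (n * Real.log (d / β)) * B ^ 2 := by ring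
        _ ≤ 4 * (n * Real.log (d / β)) * (32 ^ 2 * ((Real.logb 2 d / ε) ^ 2 * k)) :=
          mul_le_mul_of_nonneg_left hB2 (by positivity)
        _ = _ := by ring
    have hle : -α ^ 2 / (2 * (n * B ^ 2)) ≤ -(2 * Real.log (d / β)) := by
      rw [div_le_iff₀ (by positivity)]
      linarith
    have hexp2 : Real.exp (-(2 * Real.log (d / β))) = (β / d) ^ 2 := by
      rw [Real.exp_neg, two_mul, Real.exp_add, Real.exp_log (by linarith), ← sq, ← inv_pow, inv_div]
    -- As d ≥ 2 and β < 1, one spare factor β/d absorbs the 2 of the two-sided tail.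
    have h2 : 2 * (β / d) ≤ 1 := by
      rw [← mul_div_assoc, div_le_one (by linarith)]; linarith
    calc _ ≤ 2 * (β / d) ^ 2 := by
          rw [← hexp2]
          exact mul_le_mul_of_nonneg_left (Real.exp_le_exp.2 hle) (by norm_num)
      _ = 2 * (β / d) * (β / d) := by ring
      _ ≤ 1 * (β / d) := mul_le_mul_of_nonneg_right h2 (by positivity)
      _ = β / d := one_mul _
  rw [Set.ofPred_exists]
  refine (measure_iUnion_le _).trans ?_
  rw [tsum_fintype]
  calc _ ≤ ∑ _t : Fin d, ENNReal.ofReal (β / d) := by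
        refine Finset.sum_le_sum fun t _ => ?_
        refine (measure_dyadicProtocol_error_le ha ha1 hc (Nat.lt_pow_succ_log_self (by norm_num) d)
          x t hα0).trans (ENNReal.ofReal_le_ofReal ?_)
        rw [hB] at htail
        push_cast at htail
        exact htail
    _ = ENNReal.ofReal β := by
        rw [Finset.sum_const, Finset.card_univ, Fintype.card_fin, ← ENNReal.ofReal_nsmul]
        congr 1
        rw [nsmul_eq_mul]
        field_simp
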